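/- Let $\Lambda$ be a completely positive and trace-preserving (CPTP) linear map on the operators on $\mathbb{C}^2$ (a qubit channel). Let $$F_{\mathrm{avg}}(\Lambda)=\int \mathrm{d}\psi\,\mathrm{Tr}\bigl[\psi\,\Lambda(\psi)\bigr]$$ be its average gate fidelity with respect to the identity, where the integral is over pure states $\psi=|\psi\rangle\langle\psi|$ with the unitarily invariant probability measure, and let $r=1-F_{\mathrm{avg}}(\Lambda)$ be its average gate infidelity. Let $A_0,A_1,A_2,A_3$ be any basis of the operators on $\mathbb{C}^2$ that is orthonormal for the Hilbert--Schmidt inner product $\langle A,B\rangle=\mathrm{Tr}(A^\dagger B)$ and satisfies $A_0=\mathbb{1}/\sqrt{2}$. In this basis the matrix $\bigl(\langle A_k,\Lambda(A_j)\rangle\bigr)_{k,j}$ of $\Lambda$ has the form $\begin{pmatrix}1&0\\ \alpha&\varphi\end{pmatrix}$; its lower left block, the vector $\alpha=\bigl(\langle A_k,\Lambda(A_0)\rangle\bigr)_{k=1,2,3}\in\mathbb{C}^3$, is the nonunital part of $\Lambda$. If $r<1/3$, then $$\|\alpha\|_2^2\le 9r^2 ,$$ where $\|\cdot\|_2$ is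 the Euclidean norm. -/

import Mathlib

open MeasureTheory
open scoped Matrix CStarAlgebra ComplexOrder MatrixOrder Matrix.Norms.L2Operator

/-- Linear operators on the Hilbert space `ℂ^d`, as complex `d × d` matrices, with the operator
norm and the Löwner order (`0 ≤ X` iff `X` is positive semidefinite). -/
abbrev Operator (d : ℕ) : Type := Matrix (Fin d) (Fin d) ℂ

/-- A quantum channel on a `d`-level system: a (`ℂ`-linear) completely positive and
trace-preserving map on the operators on `ℂ^d`. -/
structure QuantumChannel (d : ℕ) extends Operator d →CP Operator d where
  trace_map' : ∀ X : Operator d, (toLinearMap X).trace = X.trace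

/-- The unit vectors of `ℂ^d`. -/
abbrev UnitVector (d : ℕ) : Type := Metric.sphere (0 : EuclideanSpace ℂ (Fin d)) 1

/-- The pure state `|ψ⟩⟨ψ|` of a unit vector `ψ`. -/
def pureState {d : ℕ} (ψ : UnitVector d) : Operator d :=
  Matrix.of fun i j => ψ.1 i * star (ψ.1 j)

/-- The uniform (unitarily invariant) probability measure on the unit vectors of `ℂ^d`: the surface
measure of the unit sphere induced by Lebesgue measure, divided by its total mass. -/
noncomputable def haarUnitVector (d : ℕ) : Measure (UnitVector d) :=
  ((Measure.addHaar (G := EuclideanSpace ℂ (Fin d))).toSphere Set.univ)⁻¹ •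
    (Measure.addHaar (G := EuclideanSpace ℂ (Fin d))).toSphere

namespace QuantumChannel

variable {d : ℕ}

/-- The average gate fidelity with respect to the identity, `∫ dψ Tr[ψ Λ(ψ)]`; the trace is a real
number, since `ψ` and `Λ(ψ)` are positive semidefinite. -/
noncomputable def avgGateFidelity (Λ : QuantumChannel d) : ℝ :=
  ∫ ψ, (pureState ψ * Λ.toLinearMap (pureState ψ)).trace.re ∂haarUnitVector d

/-- The average gate infidelity `r = 1 - F_avg(Λ)`. -/
noncomputable def avgGateInfidelity (Λ : QuantumChannel d) : ℝ :=
  1 - Λ.avgGateFidelity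

end QuantumChannel

/-- The Hilbert-Schmidt inner product `Tr(A† B)`. -/
def hsInner {d : ℕ} (A B : Operator d) : ℂ := (Aᴴ * B).trace

/-- `A₀, …, A_{d²-1}` is a basis of the operators on `ℂ^d`, orthonormal for the Hilbert-Schmidt
inner product, with `A₀ = 1/√d`. (Orthonormality makes `d²` operators a basis, and makes the other
`A_j` traceless.) -/
structure IsLiouvilleBasis {d : ℕ} [NeZero d] (A : Fin (d ^ 2) → Operator d) : Prop where
  orthonormal : ∀ i j, hsInner (A i) (A j) = if i = j then 1 else 0
  zero_eq : A 0 = ((Real.sqrt d : ℝ) : ℂ)⁻¹ • (1 : Operator d)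

namespace QuantumChannel

variable {d : ℕ}

/-- The Liouville representation: the matrix `⟨A_k, Λ(A_j)⟩` (row `k`, column `j`), which maps the
vector of coefficients of `ρ` to that of `Λ(ρ)`. -/
noncomputable def liouville (Λ : QuantumChannel d) (A : Fin (d ^ 2) → Operator d) :
    Matrix (Fin (d ^ 2)) (Fin (d ^ 2)) ℂ :=
  Matrix.of fun k j => hsInner (A k) (Λ.toLinearMap (A j))

/-- The nonunital part `α` of `Λ`: the lower left block of the Liouville representation
`[[1, 0], [α, φ]]`, i.e. its column `0` without the entry in row `0`. -/
noncomputable def nonunitalPart [NeZero d] (Λ : QuantumChannel d) (A : Fin (d ^ 2) → Operator d) :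
    EuclideanSpace ℂ {j : Fin (d ^ 2) // j ≠ 0} :=
  WithLp.toLp 2 fun j => Λ.liouville A j.1 0

end QuantumChannel

/-! Since `A 0` is orthogonal to the other basis elements, `α` consists of coefficients of `Λ(A₀) -
A₀`, and Bessel's inequality gives `‖α‖² ≤ ‖Λ(1) - 1‖²/2` in Hilbert–Schmidt norm. The operator
`Λ(1) - 1` is Hermitian and traceless, with eigenvalues `±δ`, so the right side is `δ²`, and it
remains to see that `δ ≤ 3r`.

This is the operator bound `Λ(1) ≥ 1 - 3r` (`posSemidef_apply_one_sub`). With `F_e` the process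
fidelity, fourth moments of random states give `3 F_avg = 1 + 2 F_e` (`avgGateFidelity_eq`), hence
`1 - 3r = 2 F_e - 1`. Evaluating the Choi form at two vectors adapted to a given state, and using
trace preservation, yields `Λ(1) ≥ 2 F_e - 1` (`quadraticForm_apply_one`). -/

/-! ### Complete positivity and the Choi matrix -/

/-- The quadratic form of a positive matrix of operators is nonnegative. -/
theorem CStarMatrix.quadraticForm_nonneg {n d : ℕ}
    {N : CStarMatrix (Fin n) (Fin n) (Operator d)} (hN : 0 ≤ N) (y : Fin n → Fin d → ℂ) :
    0 ≤ ∑ i, ∑ j, ∑ a, ∑ b, star (y i a) * N i j a b * y j b := by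
  rw [StarOrderedRing.nonneg_iff] at hN
  induction hN using AddSubmonoid.closure_induction with
  | mem N hN =>
    obtain ⟨C, rfl⟩ := hN
    have h2 : ∀ i j a b, (star C * C) i j a b = ∑ k, ∑ c, star (C k i c a) * C k j c b := by
      intro i j a b
      simp [CStarMatrix.mul_apply, CStarMatrix.star_apply, Matrix.sum_apply, Matrix.mul_apply,
        Matrix.star_eq_conjTranspose]
    have h3 : ∑ i, ∑ j, ∑ a, ∑ b, star (y i a) * (star C * C) i j a b * y j b =
        ∑ k, ∑ c, star (∑ i, ∑ a, C k i c a * y i a) * ∑ j, ∑ b, C k j c b * y j b := by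
      let e : (Fin n × Fin n × Fin d × Fin d × Fin n × Fin d) ≃
          (Fin n × Fin d × Fin n × Fin d × Fin n × Fin d) :=
        { toFun := fun (i, j, a, b, k, c) => (k, c, j, b, i, a)
          invFun := fun (k, c, j, b, i, a) => (i, j, a, b, k, c)
          left_inv := fun _ => rfl
          right_inv := fun _ => rfl }
      have := Fintype.sum_equiv e
        (fun (i, j, a, b, k, c) => star (y i a) * (star (C k i c a) * C k j c b) * y j b)
        (fun (k, c, j, b, i, a) => star (C k i c a) * star (y i a) * (C k j c b * y j b))
        (fun _ => by simp only [e, Equiv.coe_fn_mk]; ring)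
      simp only [Fintype.sum_prod_type] at this
      simpa only [h2, star_sum, star_mul', Finset.mul_sum, Finset.sum_mul] using this
    rw [h3]
    exact Finset.sum_nonneg fun k _ => Finset.sum_nonneg fun c _ => star_mul_self_nonneg _
  | zero => simp
  | add M N _ _ hM hN =>
    refine (add_nonneg hM hN).trans_eq ?_
    simp [← Finset.sum_add_distrib, mul_add, add_mul]

/-- The Choi matrix of a quantum channel is positive semidefinite. -/
theorem QuantumChannel.choi_nonneg {d : ℕ} (Λ : QuantumChannel d) (y : Fin d → Fin d → ℂ) :
    0 ≤ ∑ i, ∑ j, ∑ a, ∑ b, star (y i a) * Λ.toLinearMap (Matrix.single i j 1) a b * y j b := by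
  have h0 : (0 : CStarMatrix (Fin d) (Fin d) (Operator d)) ≤
      CStarMatrix.ofMatrix (Matrix.of fun i j => Matrix.single i j (1 : ℂ)) := by
    rcases Nat.eq_zero_or_pos d with rfl | hd
    · exact le_of_eq (Subsingleton.elim _ _)
    -- The matrix units form a matrix `star C * C`, where `C` has the single nonzero row `E_{0j}`:
    -- `E_{i0} E_{0j} = E_{ij}`.
    have := star_mul_self_nonneg (CStarMatrix.ofMatrix (Matrix.of fun i j : Fin d =>
      if i = ⟨0, hd⟩ then Matrix.single (⟨0, hd⟩ : Fin d) j (1 : ℂ) else 0) :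
      CStarMatrix (Fin d) (Fin d) (Operator d))
    convert this using 1
    ext i j : 2
    simp [CStarMatrix.mul_apply, CStarMatrix.star_apply, Matrix.star_eq_conjTranspose, apply_ite]
  exact CStarMatrix.quadraticForm_nonneg (Λ.map_cstarMatrix_nonneg' d _ h0) y

/-! ### Invariance of the measure on the unit sphere -/

/-- A linear isometry preserves every additive Haar measure. -/
theorem LinearIsometryEquiv.measurePreserving_addHaar {E : Type*}
    [NormedAddCommGroup E] [NormedSpace ℝ E] [FiniteDimensional ℝ E] [MeasurableSpace E] [BorelSpace E] (μ : Measure E)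
    [μ.IsAddHaarMeasure] (g : E ≃ₗᵢ[ℝ] E) : MeasurePreserving g μ μ := by
  refine ⟨g.continuous.measurable, ?_⟩
  have : (μ.map g).IsAddHaarMeasure := g.toContinuousLinearEquiv.isAddHaarMeasure_map μ
  have h := Measure.isAddLeftInvariant_eq_smul (μ.map g) μ
  -- Haar measures differ by a scalar; the invariant unit ball, of finite positive measure, forces
  -- it to be 1.
  have hb : μ.map g (Metric.ball 0 1) = μ (Metric.ball 0 1) := by
    rw [Measure.map_apply g.continuous.measurable Metric.isOpen_ball.measurableSet]
    congr 1
    ext x; simp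
  rw [h, Measure.smul_apply, ENNReal.smul_def, smul_eq_mul] at hb
  have hc := (ENNReal.mul_eq_right (Metric.measure_ball_pos μ 0 one_pos).ne'
    measure_ball_lt_top.ne).mp hb
  rw [h]
  ext s
  rw [Measure.smul_apply, ENNReal.smul_def, hc, one_smul]

/-- A linear isometry restricted to the unit sphere. -/
def sphereMap {E : Type*} [NormedAddCommGroup E] [NormedSpace ℝ E] (g : E ≃ₗᵢ[ℝ] E)
    (x : Metric.sphere (0 : E) 1) : Metric.sphere (0 : E) 1 :=
  ⟨g x, by simp⟩

/-- Linear isometries preserve the surface measure of the unit sphere. -/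
theorem measurePreserving_sphereMap {E : Type*} [NormedAddCommGroup E] [NormedSpace ℝ E]
    [FiniteDimensional ℝ E] [MeasurableSpace E] [BorelSpace E] (μ : Measure E)
    [μ.IsAddHaarMeasure] (g : E ≃ₗᵢ[ℝ] E) :
    MeasurePreserving (sphereMap g) μ.toSphere μ.toSphere := by
  have hm : Measurable (sphereMap g) :=
    (g.continuous.comp continuous_subtype_val).measurable.subtype_mk
  refine ⟨hm, ?_⟩
  ext s hs
  rw [Measure.map_apply hm hs, μ.toSphere_apply' hs, μ.toSphere_apply' (hm hs)]
  congr 1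
  -- `toSphere` measures a set through the cone over it, and `g` commutes with forming cones.
  refine Eq.trans (congrArg μ ?_) ((g.measurePreserving_addHaar μ).measure_preimage_equiv
    (f := g.toHomeomorph.toMeasurableEquiv) _)
  ext x
  simp only [Set.mem_smul, Set.mem_image, Set.mem_preimage]
  constructor
  · rintro ⟨t, ht, _, ⟨z, hz, rfl⟩, rfl⟩
    exact ⟨t, ht, _, ⟨_, hz, rfl⟩, by simp [sphereMap]⟩
  · rintro ⟨t, ht, _, ⟨z, hz, rfl⟩, h⟩
    refine ⟨t, ht, _, ⟨sphereMap g.symm z, ?_, rfl⟩, ?_⟩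
    · simpa [sphereMap] using hz
    · apply g.injective
      simpa [sphereMap] using h

instance (d : ℕ) [NeZero d] : IsProbabilityMeasure (haarUnitVector d) where
  measure_univ := by
    rw [haarUnitVector, Measure.smul_apply, smul_eq_mul]
    refine ENNReal.inv_mul_cancel ?_ (measure_ne_top _ _)
    exact fun h => Measure.toSphere_ne_zero (E := EuclideanSpace ℂ (Fin d)) Measure.addHaar
      (Measure.measure_univ_eq_zero.mp h)

/-- The uniform measure on unit vectors is unitarily invariant. -/
theorem integral_haarUnitVector_comp {d : ℕ} {G : Type*} [NormedAddCommGroup G] [NormedSpace ℝ G]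
    (g : EuclideanSpace ℂ (Fin d) ≃ₗᵢ[ℂ] EuclideanSpace ℂ (Fin d))
    (f : EuclideanSpace ℂ (Fin d) → G) :
    ∫ ψ, f (g ψ.1) ∂haarUnitVector d = ∫ ψ, f ψ.1 ∂haarUnitVector d := by
  let g' : EuclideanSpace ℂ (Fin d) ≃ₗᵢ[ℝ] EuclideanSpace ℂ (Fin d) :=
    { g.toLinearEquiv.restrictScalars ℝ with norm_map' := g.norm_map }
  have hm := measurePreserving_sphereMap
    (Measure.addHaar (G := EuclideanSpace ℂ (Fin d))) g'
  have he : MeasurableEmbedding (sphereMap g') := by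
    have h : Function.LeftInverse (sphereMap g'.symm) (sphereMap g') := fun x => by
      simp [sphereMap]
    refine Topology.IsClosedEmbedding.measurableEmbedding (Continuous.isClosedEmbedding ?_
      h.injective)
    exact (g'.continuous.comp continuous_subtype_val).subtype_mk _
  simp only [haarUnitVector, integral_smul_measure]
  congr 1
  exact hm.integral_comp he (fun ψ => f ψ.1)

/-! ### Fourth-order moments of qubit states -/

/-- The linear isometry of `ℂ²` with matrix `[[u, -v̄ w], [v, ū w]]`. -/
noncomputable def qubitIsometry (u v w : ℂ) (h : star u * u + star v * v = 1) (hw : star w * w = 1) :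
    EuclideanSpace ℂ (Fin 2) ≃ₗᵢ[ℂ] EuclideanSpace ℂ (Fin 2) :=
  LinearIsometry.toLinearIsometryEquiv
    { Matrix.toEuclideanLin !![u, -(star v * w); v, star u * w] with
      norm_map' := fun x => by
        rw [← sq_eq_sq₀ (norm_nonneg _) (norm_nonneg _), ← Complex.ofReal_inj]
        simp only [EuclideanSpace.norm_sq_eq, Fin.sum_univ_two, Complex.ofReal_add,
          Complex.ofReal_pow, ← Complex.conj_mul', starRingEnd_apply]
        simp [Matrix.toLpLin_apply, dotProduct] at h hw ⊢
        linear_combination (starRingEnd ℂ (x 0) * x 0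
          + starRingEnd ℂ w * w * (starRingEnd ℂ (x 1) * x 1)) * h
          + starRingEnd ℂ (x 1) * x 1 * hw } rfl

theorem qubitIsometry_apply_zero (u v w : ℂ) (h hw) (x : EuclideanSpace ℂ (Fin 2)) :
    qubitIsometry u v w h hw x 0 = u * x 0 - star v * w * x 1 := by
  simp [qubitIsometry, Matrix.toLpLin_apply, dotProduct, sub_eq_add_neg]

theorem qubitIsometry_apply_one (u v w : ℂ) (h hw) (x : EuclideanSpace ℂ (Fin 2)) :
    qubitIsometry u v w h hw x 1 = v * x 0 + star u * w * x 1 := by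
  simp [qubitIsometry, Matrix.toLpLin_apply, dotProduct]

theorem integral_qubit_comp (f : ℂ → ℂ → ℝ) (u v w : ℂ) (h : star u * u + star v * v = 1)
    (hw : star w * w = 1) :
    ∫ ψ, f (u * ψ.1 0 - star v * w * ψ.1 1) (v * ψ.1 0 + star u * w * ψ.1 1) ∂haarUnitVector 2 =
      ∫ ψ, f (ψ.1 0) (ψ.1 1) ∂haarUnitVector 2 := by
  simpa only [qubitIsometry_apply_zero, qubitIsometry_apply_one] using
    integral_haarUnitVector_comp (qubitIsometry u v w h hw) fun x => f (x 0) (x 1)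

theorem integrable_qubit {f : ℂ → ℂ → ℝ} (hf : Continuous fun p : ℂ × ℂ => f p.1 p.2) :
    Integrable (fun ψ => f (ψ.1 0) (ψ.1 1)) (haarUnitVector 2) := by
  have hc : Continuous fun ψ : UnitVector 2 => f (ψ.1 0) (ψ.1 1) :=
    hf.comp (f := fun ψ : UnitVector 2 => (ψ.1 0, ψ.1 1)) (by fun_prop)
  exact hc.integrable_of_hasCompactSupport (HasCompactSupport.of_compactSpace _)

/-- An integral over qubit pure states is unchanged by averaging over four relative phases. -/
theorem integral_qubit_phase {f : ℂ → ℂ → ℝ} (hf : Continuous fun p : ℂ × ℂ => f p.1 p.2) :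
    ∫ ψ, f (ψ.1 0) (ψ.1 1) ∂haarUnitVector 2 =
      ∫ ψ, (f (ψ.1 0) (ψ.1 1) + f (ψ.1 0) (Complex.I * ψ.1 1) + f (ψ.1 0) (-ψ.1 1)
        + f (ψ.1 0) (-(Complex.I * ψ.1 1))) / 4 ∂haarUnitVector 2 := by
  have key (w : ℂ) (hw : star w * w = 1) : ∫ ψ, f (ψ.1 0) (w * ψ.1 1) ∂haarUnitVector 2 =
      ∫ ψ, f (ψ.1 0) (ψ.1 1) ∂haarUnitVector 2 := by
    simpa using integral_qubit_comp f 1 0 w (by simp) hw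
  have hi (w : ℂ) : Integrable (fun ψ => f (ψ.1 0) (w * ψ.1 1)) (haarUnitVector 2) :=
    integrable_qubit (f := fun x y => f x (w * y))
      (hf.comp (f := fun p : ℂ × ℂ => (p.1, w * p.2)) (by fun_prop))
  have h1 := key Complex.I (by simp)
  have h2 := key (-1) (by simp)
  have h3 := key (-Complex.I) (by simp)
  have i0 := integrable_qubit hf
  have i1 := hi Complex.I
  have i2 := hi (-1)
  have i3 := hi (-Complex.I)
  simp only [neg_mul, one_mul] at h2 h3 i2 i3
  rw [integral_div, integral_add ((i0.fun_add i1).fun_add i2) i3, integral_add (i0.fun_add i1) i2,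
    integral_add i0 i1, h1, h2, h3]
  ring

theorem UnitVector.normSq_add (ψ : UnitVector 2) :
    Complex.normSq (ψ.1 0) + Complex.normSq (ψ.1 1) = 1 := by
  have h : ‖ψ.1‖ = 1 := by simp
  have := EuclideanSpace.norm_sq_eq ψ.1
  rw [h, Fin.sum_univ_two] at this
  simp only [Complex.normSq_eq_norm_sq]
  linarith

/-- The fourth-order moments of a uniformly random qubit state. -/
theorem qubit_moments :
    ∫ ψ, Complex.normSq (ψ.1 0) ^ 2 ∂haarUnitVector 2 = 1 / 3 ∧
    ∫ ψ, Complex.normSq (ψ.1 1) ^ 2 ∂haarUnitVector 2 = 1 / 3 ∧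
    ∫ ψ, Complex.normSq (ψ.1 0) * Complex.normSq (ψ.1 1) ∂haarUnitVector 2 = 1 / 6 := by
  have hn := Complex.continuous_normSq
  have i1 : Integrable (fun ψ => Complex.normSq (ψ.1 0) ^ 2) (haarUnitVector 2) :=
    integrable_qubit (f := fun x _ => Complex.normSq x ^ 2) (by fun_prop)
  have i2 : Integrable (fun ψ => Complex.normSq (ψ.1 1) ^ 2) (haarUnitVector 2) :=
    integrable_qubit (f := fun _ y => Complex.normSq y ^ 2) (by fun_prop)
  have i3 : Integrable (fun ψ => Complex.normSq (ψ.1 0) * Complex.normSq (ψ.1 1))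
      (haarUnitVector 2) :=
    integrable_qubit (f := fun x y => Complex.normSq x * Complex.normSq y) (by fun_prop)
  -- Three linear relations determine the moments: a coordinate swap, a Hadamard-type rotation
  -- combined with phase averaging, and normalization.
  have hswap := integral_qubit_comp (fun x _ => Complex.normSq x ^ 2) 0 1 (-1) (by simp) (by simp)
  have hs : star ((√2 : ℝ)⁻¹ : ℂ) * ((√2 : ℝ)⁻¹ : ℂ) = 1 / 2 := by
    rw [star_inv₀, Complex.star_def, Complex.conj_ofReal, ← mul_inv, ← Complex.ofReal_mul,
      Real.mul_self_sqrt (by norm_num)]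
    norm_num
  have hhad := integral_qubit_comp (fun x _ => Complex.normSq x ^ 2) ((√2 : ℝ)⁻¹ : ℂ)
    ((√2 : ℝ)⁻¹ : ℂ) (-1) (by rw [hs]; norm_num) (by simp)
  have hnorm : ∫ ψ, (Complex.normSq (ψ.1 0) ^ 2 + Complex.normSq (ψ.1 1) ^ 2
      + 2 * (Complex.normSq (ψ.1 0) * Complex.normSq (ψ.1 1))) ∂haarUnitVector 2 = 1 := by
    calc _ = ∫ ψ, (1 : ℝ) ∂haarUnitVector 2 := by
          refine integral_congr_ae (.of_forall fun ψ => ?_)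
          linear_combination (Complex.normSq (ψ.1 0) + Complex.normSq (ψ.1 1) + 1) * ψ.normSq_add
      _ = 1 := by simp
  have hphase := integral_qubit_phase (f := fun x y => Complex.normSq (x + y) ^ 2 / 4)
    (by fun_prop)
  have hphase' : ∫ ψ, Complex.normSq (ψ.1 0 + ψ.1 1) ^ 2 / 4 ∂haarUnitVector 2 =
      ∫ ψ, (1 / 4 + 1 / 2 * (Complex.normSq (ψ.1 0) * Complex.normSq (ψ.1 1)))
        ∂haarUnitVector 2 := by
    rw [hphase]
    refine integral_congr_ae (.of_forall fun ψ => ?_)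
    have h := ψ.normSq_add
    simp [Complex.normSq_apply] at h ⊢
    linear_combination ((ψ.1 0).re * (ψ.1 0).re + (ψ.1 0).im * (ψ.1 0).im +
      (ψ.1 1).re * (ψ.1 1).re + (ψ.1 1).im * (ψ.1 1).im + 1) / 4 * h
  have hhad' : ∫ ψ, Complex.normSq (ψ.1 0 + ψ.1 1) ^ 2 / 4 ∂haarUnitVector 2 =
      ∫ ψ, Complex.normSq (ψ.1 0) ^ 2 ∂haarUnitVector 2 := by
    rw [← hhad]
    refine integral_congr_ae (.of_forall fun ψ => ?_)
    have : ((√2 : ℝ)⁻¹ : ℂ) * ψ.1 0 - star ((√2 : ℝ)⁻¹ : ℂ) * -1 * ψ.1 1 =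
        ((√2)⁻¹ : ℝ) * (ψ.1 0 + ψ.1 1) := by
      simp
      ring
    simp only [this, Complex.normSq_mul, Complex.normSq_ofReal, ← mul_inv]
    norm_num
    ring
  rw [integral_add (i1.fun_add i2) (i3.const_mul 2), integral_add i1 i2, integral_const_mul] at hnorm
  rw [hhad', integral_add (integrable_const _) (i3.const_mul _), integral_const_mul] at hphase'
  simp at hswap hphase'
  refine ⟨?_, ?_, ?_⟩ <;> linarith

/-! ### Average fidelity and process fidelity -/

theorem LinearMap.apply_pureState {d : ℕ} (f : Operator d →ₗ[ℂ] Operator d) (ψ : UnitVector d) :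
    f (pureState ψ) = ∑ i, ∑ j, (ψ.1 i * star (ψ.1 j)) • f (Matrix.single i j 1) := by
  conv_lhs => rw [Matrix.matrix_eq_sum_single (pureState ψ)]
  simp only [map_sum]
  refine Finset.sum_congr rfl fun i _ => Finset.sum_congr rfl fun j _ => ?_
  rw [← map_smul, Matrix.smul_single, smul_eq_mul, mul_one]
  rfl

theorem QuantumChannel.trace_apply_single {d : ℕ} (Λ : QuantumChannel d) (i j : Fin d) :
    ∑ a, Λ.toLinearMap (Matrix.single i j 1) a a = if i = j then 1 else 0 := by
  have := Λ.trace_map' (Matrix.single i j 1)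
  rw [Matrix.trace] at this
  simp only [Matrix.diag_apply] at this
  rw [this]
  split_ifs with h
  · subst h; simp
  · simp [h]

/-- The average gate fidelity of a qubit channel in terms of its process fidelity. -/
theorem QuantumChannel.avgGateFidelity_eq (Λ : QuantumChannel 2) :
    3 * Λ.avgGateFidelity =
      1 + (∑ i, ∑ j, Λ.toLinearMap (Matrix.single i j 1) i j).re / 2 := by
  set L : Fin 2 → Fin 2 → Operator 2 := fun i j => Λ.toLinearMap (Matrix.single i j 1) with hL
  let t : ℂ → ℂ → ℂ := fun x y => ∑ a, ∑ b, ∑ i, ∑ j,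
    ![x, y] a * star (![x, y] b) * (![x, y] i * star (![x, y] j)) * L i j b a
  have ht (ψ : UnitVector 2) :
      (pureState ψ * Λ.toLinearMap (pureState ψ)).trace = t (ψ.1 0) (ψ.1 1) := by
    rw [LinearMap.apply_pureState]
    simp [t, hL, Matrix.trace, Matrix.mul_apply, Fin.sum_univ_two, pureState]
    ring
  have hcont : Continuous fun p : ℂ × ℂ => (t p.1 p.2).re := by
    simp only [t, Fin.sum_univ_two]
    simp
    fun_prop
  have h0 := Λ.trace_apply_single 0 0
  have h1 := Λ.trace_apply_single 1 1
  -- The relative phase enters with frequencies from -2 to 2; averaging over fourth roots of unity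
  -- leaves only frequency 0.
  have hav (x y : ℂ) : (t x y + t x (Complex.I * y) + t x (-y) + t x (-(Complex.I * y))) / 4 =
      Complex.normSq x ^ 2 * L 0 0 0 0 + Complex.normSq y ^ 2 * L 1 1 1 1
      + Complex.normSq x * Complex.normSq y * (L 0 0 1 1 + L 1 1 0 0 + L 0 1 0 1 + L 1 0 1 0) := by
    simp only [t, Fin.sum_univ_two, Complex.normSq_eq_conj_mul_self]
    simp
    ring_nf
    simp only [Complex.I_sq, Complex.I_pow_four]
    ring
  obtain ⟨m1, m2, m3⟩ := qubit_moments
  have hn := Complex.continuous_normSq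
  have i1 : Integrable (fun ψ => Complex.normSq (ψ.1 0) ^ 2) (haarUnitVector 2) :=
    integrable_qubit (f := fun x _ => Complex.normSq x ^ 2) (by fun_prop)
  have i2 : Integrable (fun ψ => Complex.normSq (ψ.1 1) ^ 2) (haarUnitVector 2) :=
    integrable_qubit (f := fun _ y => Complex.normSq y ^ 2) (by fun_prop)
  have i3 : Integrable (fun ψ => Complex.normSq (ψ.1 0) * Complex.normSq (ψ.1 1))
      (haarUnitVector 2) :=
    integrable_qubit (f := fun x y => Complex.normSq x * Complex.normSq y) (by fun_prop)
  have hF : Λ.avgGateFidelity = ∫ ψ, (Complex.normSq (ψ.1 0) ^ 2 * (L 0 0 0 0).re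
      + Complex.normSq (ψ.1 1) ^ 2 * (L 1 1 1 1).re
      + Complex.normSq (ψ.1 0) * Complex.normSq (ψ.1 1) *
        (L 0 0 1 1 + L 1 1 0 0 + L 0 1 0 1 + L 1 0 1 0).re) ∂haarUnitVector 2 := by
    simp only [avgGateFidelity, ht]
    rw [integral_qubit_phase (f := fun x y => (t x y).re) hcont]
    refine integral_congr_ae (.of_forall fun ψ => ?_)
    have := congrArg Complex.re (hav (ψ.1 0) (ψ.1 1))
    simp only [← Complex.ofReal_pow, ← Complex.ofReal_mul, Complex.add_re, Complex.re_ofReal_mul,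
      Complex.div_ofNat_re] at this ⊢
    exact this
  rw [hF, integral_add ((i1.mul_const _).fun_add (i2.mul_const _)) (i3.mul_const _),
    integral_add (i1.mul_const _) (i2.mul_const _), integral_mul_const, integral_mul_const,
    integral_mul_const, m1, m2, m3]
  have h0 := congrArg Complex.re h0
  have h1 := congrArg Complex.re h1
  simp [Fin.sum_univ_two] at h0 h1 ⊢
  simp only [hL]
  linear_combination (h0 + h1) / 2

/-! ### Lower bound on the image of the identity -/

theorem QuantumChannel.apply_one_eq (Λ : QuantumChannel 2) (a b : Fin 2) :
    Λ.toLinearMap 1 a b = Λ.toLinearMap (Matrix.single 0 0 1) a b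
      + Λ.toLinearMap (Matrix.single 1 1 1) a b := by
  have : (1 : Operator 2) = Matrix.single 0 0 1 + Matrix.single 1 1 1 := by
    ext i j; fin_cases i <;> fin_cases j <;> simp
  rw [this, map_add, Matrix.add_apply]

/-- `Λ(1)` is bounded below by `2 F_e - 1`, with `F_e` the process fidelity of `Λ`. -/
theorem QuantumChannel.quadraticForm_apply_one (Λ : QuantumChannel 2) (x y : ℂ) :
    0 ≤ (star x * x + star y * y) *
      (star x * Λ.toLinearMap 1 0 0 * x + star x * Λ.toLinearMap 1 0 1 * y
        + star y * Λ.toLinearMap 1 1 0 * x + star y * Λ.toLinearMap 1 1 1 * y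
        - ((∑ i, ∑ j, Λ.toLinearMap (Matrix.single i j 1) i j) / 2 - 1)
          * (star x * x + star y * y)) := by
  -- For a unit vector `v = (x, y)` and `v⊥ = (-ȳ, x̄)`, `q1` tests the Choi form at the vectorized
  -- reflection `2|v⟩⟨v| - 1`, and `q2` says `⟨v|Λ(|v⊥⟩⟨v⊥|)|v⟩ ≥ 0`. The claim is `q1/2 + 2 q2`
  -- modulo trace preservation; the factor `|v|²` in it makes the degrees match.
  have q1 := Λ.choi_nonneg ![![star x * x - star y * y, 2 * star x * y],
    ![2 * x * star y, star y * y - star x * x]]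
  have q2 := Λ.choi_nonneg ![![-(y * x), -(y * y)], ![x * x, x * y]]
  have t00 := Λ.trace_apply_single 0 0
  have t01 := Λ.trace_apply_single 0 1
  have t10 := Λ.trace_apply_single 1 0
  have t11 := Λ.trace_apply_single 1 1
  have h2 : (0 : ℂ) ≤ ((1 / 2 : ℝ) : ℂ) := by exact_mod_cast one_half_pos.le
  refine (add_nonneg (mul_nonneg h2 q1) (mul_nonneg zero_le_two q2)).trans_eq ?_
  simp only [Λ.apply_one_eq, Fin.sum_univ_two] at *
  simp [-Complex.star_def] at t00 t01 t10 t11 ⊢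
  linear_combination (starRingEnd ℂ x * x + starRingEnd ℂ y * y) *
    (starRingEnd ℂ y * y * t00 - starRingEnd ℂ y * x * t01 - starRingEnd ℂ x * y * t10
      + starRingEnd ℂ x * x * t11)

theorem QuantumChannel.isHermitian_apply_one {d : ℕ} (Λ : QuantumChannel d) :
    (Λ.toLinearMap 1).IsHermitian := by
  have h : (0 : Operator d) ≤ 1 := zero_le_one
  exact (Matrix.nonneg_iff_posSemidef.mp (map_nonneg Λ.toCompletelyPositiveMap h)).isHermitian

/-- The sum is the Choi form at the unnormalized maximally entangled vector, hence real; its real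
part comes from the average fidelity. -/
theorem QuantumChannel.sum_apply_single_eq (Λ : QuantumChannel 2) :
    (∑ i, ∑ j, Λ.toLinearMap (Matrix.single i j 1) i j) / 2 - 1 =
      ((1 - 3 * Λ.avgGateInfidelity : ℝ) : ℂ) := by
  have h := Λ.choi_nonneg fun i a => if i = a then 1 else 0
  simp only [apply_ite star, star_one, star_zero, ite_mul, mul_ite, one_mul, mul_one, zero_mul,
    mul_zero, Finset.sum_ite_eq, Finset.mem_univ, if_true] at h
  have him := (Complex.le_def.mp h).2
  have hF := Λ.avgGateFidelity_eq
  rw [avgGateInfidelity]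
  apply Complex.ext
  · rw [Complex.ofReal_re, Complex.sub_re, Complex.div_ofNat_re, Complex.one_re]
    linarith
  · rw [Complex.ofReal_im, Complex.sub_im, Complex.div_ofNat_im, ← him]
    simp

/-- `Λ(1)` is bounded below by `1 - 3r`. -/
theorem QuantumChannel.posSemidef_apply_one_sub (Λ : QuantumChannel 2) :
    (Λ.toLinearMap 1
      - ((1 - 3 * Λ.avgGateInfidelity : ℝ) : ℂ) • (1 : Operator 2)).PosSemidef := by
  refine .of_dotProduct_mulVec_nonneg ?_ fun x => ?_
  · refine Λ.isHermitian_apply_one.sub ?_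
    rw [Matrix.IsHermitian, Matrix.conjTranspose_smul, Matrix.conjTranspose_one,
      Complex.star_def, Complex.conj_ofReal]
  · have h := Λ.quadraticForm_apply_one (x 0) (x 1)
    rw [sum_apply_single_eq] at h
    set c := ((1 - 3 * Λ.avgGateInfidelity : ℝ) : ℂ)
    have hN : star (x 0) * x 0 + star (x 1) * x 1 =
        ((Complex.normSq (x 0) + Complex.normSq (x 1) : ℝ) : ℂ) := by
      simp [Complex.normSq_eq_conj_mul_self]
    have hn0 := Complex.normSq_nonneg (x 0)
    have hn1 := Complex.normSq_nonneg (x 1)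
    rcases (add_nonneg hn0 hn1).eq_or_lt with h0 | hpos
    · have e0 : x 0 = 0 := Complex.normSq_eq_zero.mp (by linarith)
      have e1 : x 1 = 0 := Complex.normSq_eq_zero.mp (by linarith)
      simp [dotProduct, e0, e1]
    · have hinv : (0 : ℂ) ≤ (((Complex.normSq (x 0) + Complex.normSq (x 1))⁻¹ : ℝ) : ℂ) := by
        exact_mod_cast (inv_pos.mpr hpos).le
      have := mul_nonneg hinv h
      rw [← mul_assoc, hN, ← Complex.ofReal_mul, inv_mul_cancel₀ hpos.ne', Complex.ofReal_one,
        one_mul, ← hN] at this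
      refine this.trans_eq ?_
      simp [dotProduct, Matrix.mulVec, Fin.sum_univ_two, Matrix.sub_apply]
      ring

/-- The deviation of `Λ(1)` from the identity is at most `3r`. -/
theorem QuantumChannel.apply_one_deviation (Λ : QuantumChannel 2) :
    ‖Λ.toLinearMap 1 0 0 - 1‖ ^ 2 + ‖Λ.toLinearMap 1 0 1‖ ^ 2 ≤
      9 * Λ.avgGateInfidelity ^ 2 := by
  -- As `Λ(1) - 1` is Hermitian and traceless, this determinant is `9r² - δ²`.
  have hd := (Complex.le_def.mp Λ.posSemidef_apply_one_sub.det_nonneg).1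
  have hH := Λ.isHermitian_apply_one
  have h00 := hH.apply 0 0
  have h01 := hH.apply 1 0
  have ht := Λ.trace_map' 1
  rw [Matrix.det_fin_two] at hd
  simp [Matrix.trace, Fin.sum_univ_two, ← h01] at hd ht
  have him := congrArg Complex.im h00
  have htr := congrArg Complex.re ht
  simp at him htr
  simp only [← Complex.normSq_eq_norm_sq, Complex.normSq_apply]
  have hi0 : (Λ.toLinearMap 1 0 0).im = 0 := by linarith
  have hr1 : (Λ.toLinearMap 1 1 1).re = 2 - (Λ.toLinearMap 1 0 0).re := by linarith
  rw [hi0, hr1] at hd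
  simp [hi0]
  linarith

/-! ### The nonunital part in Hilbert–Schmidt geometry -/

/-- The Hilbert-Schmidt inner product is the Euclidean one on matrix entries. -/
theorem hsInner_eq_inner {d : ℕ} (A B : Operator d) :
    hsInner A B = inner ℂ
      (WithLp.toLp 2 fun p => A p.1 p.2 : EuclideanSpace ℂ (Fin d × Fin d))
      (WithLp.toLp 2 fun p : Fin d × Fin d => B p.1 p.2) := by
  simp only [hsInner, Matrix.trace, Matrix.diag_apply, Matrix.mul_apply, PiLp.inner_apply,
    Fintype.sum_prod_type, Matrix.conjTranspose_apply, RCLike.inner_apply]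
  rw [Finset.sum_comm]
  refine Finset.sum_congr rfl fun i _ => Finset.sum_congr rfl fun j _ => ?_
  simp [mul_comm]

/-- The nonunital part of `Λ` is bounded by the deviation of `Λ(A₀)` from `A₀`. -/
theorem QuantumChannel.norm_nonunitalPart_sq_le {d : ℕ} [NeZero d] (Λ : QuantumChannel d)
    {A : Fin (d ^ 2) → Operator d} (hA : IsLiouvilleBasis A) :
    ‖Λ.nonunitalPart A‖ ^ 2 ≤ ∑ i, ∑ j, ‖(Λ.toLinearMap (A 0) - A 0) i j‖ ^ 2 := by
  let V (B : Operator d) : EuclideanSpace ℂ (Fin d × Fin d) := WithLp.toLp 2 fun p => B p.1 p.2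
  have hv : Orthonormal ℂ fun j : {j : Fin (d ^ 2) // j ≠ 0} => V (A j) := by
    rw [orthonormal_iff_ite]
    intro i j
    rw [← hsInner_eq_inner, hA.orthonormal]
    simp [Subtype.ext_iff]
  -- Bessel's inequality suffices, so completeness of the basis plays no role.
  have h := hv.sum_inner_products_le (V (Λ.toLinearMap (A 0) - A 0)) (s := Finset.univ)
  rw [EuclideanSpace.norm_sq_eq (V _), Fintype.sum_prod_type] at h
  rw [EuclideanSpace.norm_sq_eq]
  refine le_trans (Finset.sum_le_sum fun j _ => le_of_eq ?_) h
  rw [← hsInner_eq_inner, hsInner, mul_sub, Matrix.trace_sub]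
  have h0 := hA.orthonormal j 0
  rw [if_neg j.2, hsInner] at h0
  rw [h0, sub_zero]
  rfl

theorem mainTheorem9 (Λ : QuantumChannel 2) (A : Fin (2 ^ 2) → Operator 2)
    (hA : IsLiouvilleBasis A) (hr : Λ.avgGateInfidelity < 1 / 3) :
    ‖Λ.nonunitalPart A‖ ^ 2 ≤ 9 * Λ.avgGateInfidelity ^ 2 := by
  refine (Λ.norm_nonunitalPart_sq_le hA).trans (Eq.trans_le ?_ Λ.apply_one_deviation)
  have hH := Λ.isHermitian_apply_one
  have h01 := hH.apply 1 0
  have ht := Λ.trace_map' 1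
  simp [Matrix.trace, Fin.sum_univ_two] at ht
  have h11 : Λ.toLinearMap 1 1 1 - 1 = -(Λ.toLinearMap 1 0 0 - 1) := by
    linear_combination ht
  rw [hA.zero_eq, map_smul, ← smul_sub]
  -- The factor 1/2 from `A 0` cancels the doubling: the two diagonal entries of `Λ(1) - 1` have
  -- equal modulus, as do the off-diagonal ones.
  have hs : ‖((Real.sqrt (2 : ℕ) : ℝ) : ℂ)⁻¹‖ ^ 2 = 1 / 2 := by
    rw [norm_inv, Complex.norm_real, inv_pow, Real.norm_eq_abs, sq_abs]
    norm_num
  simp only [Matrix.smul_apply, smul_eq_mul, norm_mul, mul_pow, hs, Matrix.sub_apply,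
    Fin.sum_univ_two, Matrix.one_apply_eq, h11, norm_neg, ← h01]
  simp
  ring
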